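/- Let $n\ge 1$ and let $L\subset\mathbb{R}^n$ be a lattice, i.e. the $\mathbb{Z}$-span of a basis of $\mathbb{R}^n$ with its standard inner product $(\cdot,\cdot)$. Let $\min(L)=\min\{(x,x)\mid 0\ne x\in L\}$ and let $\mathrm{Min}(L)=\{x\in L\mid (x,x)=\min(L)\}$ be the set of minimal vectors. Suppose that $L$ is strongly perfect, i.e. $\mathrm{Min}(L)$ is a spherical $4$-design: for every polynomial $p\in\mathbb{R}[x_1,\dots,x_n]$ of degree at most $4$, $$\frac{1}{|\mathrm{Min}(L)|}\sum_{x\in \mathrm{Min}(L)}p(x)=\int_{S}p(x)\,dx,\qquad S=\{x\in\mathbb{R}^n\mid (x,x)=\min(L)\},$$ where $dx$ is the rotation-invariant measure on $S$ of total mass $1$. Then: 1. $L$ is strongly eutactic: there is a real number $c>0$ with $I_n=\sum_{x\in \mathrm{Min}(L)}c\,xx^{\mathrm{tr}}$. 2. $L$ is perfect: the matrices $xx^{\mathrm{tr}}$, $x\in \mathrm{Min}(L)$, span the space of real symmetric $n\times n$ matrices. 3. $L$ is extreme: its similarity class is a local maximum of the Hermite function $\gamma(M)=\min(M)/\det(M)^{1/n}$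 on the space of similarity classes of lattices in $\mathbb{R}^n$. Here $\det(M)$ is the square of the covolume of $M$; two lattices $M,M'$ are similar if $\sigma(M)=M'$ for some $\sigma\in\mathrm{GL}_n(\mathbb{R})$ and $\alpha>0$ with $(\sigma x,\sigma y)=\alpha(x,y)$ for all $x,y\in\mathbb{R}^n$; and the space of similarity classes carries the quotient topology from the space $\mathrm{GL}_n(\mathbb{R})/\mathrm{GL}_n(\mathbb{Z})$ of lattices. -/

import Mathlib

open MeasureTheory
open scoped RealInnerProductSpace

noncomputable section

/-- A lattice of full rank in Euclidean `n`-space. -/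
structure EuclideanLattice (n : ℕ) where
  /-- the underlying group of vectors -/
  carrier : Submodule ℤ (EuclideanSpace ℝ (Fin n))
  discrete : DiscreteTopology carrier
  isZLattice : IsZLattice ℝ carrier

attribute [instance] EuclideanLattice.discrete EuclideanLattice.isZLattice

namespace EuclideanLattice

variable {n : ℕ}

/-! ### Minimal vectors, determinant, Hermite function -/

/-- The minimum `min {(x, x) | 0 ≠ x ∈ L}`; the infimum is attained if `n ≥ 1`. -/
def minimum (L : EuclideanLattice n) : ℝ :=
  sInf {r : ℝ | ∃ x ∈ L.carrier, x ≠ 0 ∧ ⟪x, x⟫ = r}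

theorem finite_inner_self_eq (L : EuclideanLattice n) (m : ℝ) :
    {x : EuclideanSpace ℝ (Fin n) | x ∈ L.carrier ∧ ⟪x, x⟫ = m}.Finite := by
  have : DiscreteTopology L.carrier.toAddSubgroup := inferInstanceAs (DiscreteTopology L.carrier)
  refine (Metric.finite_isBounded_inter_isClosed
    (K := Metric.closedBall (0 : EuclideanSpace ℝ (Fin n)) (Real.sqrt m))
    (s := (L.carrier.toAddSubgroup : Set (EuclideanSpace ℝ (Fin n))))
    DiscreteTopology.isDiscrete Metric.isBounded_closedBall
    AddSubgroup.isClosed_of_discrete).subset ?_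
  rintro x ⟨hx, hm⟩
  refine ⟨?_, hx⟩
  rw [mem_closedBall_zero_iff, ← hm, real_inner_self_eq_norm_sq, Real.sqrt_sq (norm_nonneg x)]

/-- The finite set `Min(L)` of minimal vectors of `L`. -/
def minVectors (L : EuclideanLattice n) : Finset (EuclideanSpace ℝ (Fin n)) :=
  (L.finite_inner_self_eq L.minimum).toFinset

theorem mem_minVectors {L : EuclideanLattice n} {x : EuclideanSpace ℝ (Fin n)} :
    x ∈ L.minVectors ↔ x ∈ L.carrier ∧ ⟪x, x⟫ = L.minimum := by
  simp [minVectors]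

/-- The determinant: the square of the covolume. -/
def det (L : EuclideanLattice n) : ℝ :=
  ZLattice.covolume L.carrier ^ 2

/-- The Hermite function `γ(L) = min(L) / det(L)^(1/n)`. -/
def hermite (L : EuclideanLattice n) : ℝ :=
  L.minimum / L.det ^ (1 / (n : ℝ))

/-! ### The space of similarity classes -/

/-- The lattice with a given basis. -/
def ofBasis (b : Module.Basis (Fin n) ℝ (EuclideanSpace ℝ (Fin n))) : EuclideanLattice n where
  carrier := Submodule.span ℤ (Set.range b)
  discrete := inferInstance
  isZLattice := inferInstance

/-- The set of bases of Euclidean space is topologized as a subset of `(ℝⁿ)ⁿ`, and the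
set of lattices as its quotient, that is, as `GLₙ(ℝ) / GLₙ(ℤ)`. -/
instance : TopologicalSpace (EuclideanLattice n) :=
  TopologicalSpace.coinduced ofBasis
    (TopologicalSpace.induced
      (fun (b : Module.Basis (Fin n) ℝ (EuclideanSpace ℝ (Fin n))) (i : Fin n) => b i)
      inferInstance)

/-- `L` and `M` are similar if `σ(L) = M` for some `σ ∈ GLₙ(ℝ)` that multiplies the inner
product by a positive constant. -/
def Similar (L M : EuclideanLattice n) : Prop :=
  ∃ (σ : EuclideanSpace ℝ (Fin n) ≃ₗ[ℝ] EuclideanSpace ℝ (Fin n)) (α : ℝ), 0 < α ∧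
    (∀ x y, ⟪σ x, σ y⟫ = α * ⟪x, y⟫) ∧
    σ '' (L.carrier : Set (EuclideanSpace ℝ (Fin n))) = M.carrier

instance similarSetoid (n : ℕ) : Setoid (EuclideanLattice n) where
  r := Similar
  iseqv := by
    refine ⟨fun L => ⟨LinearEquiv.refl ℝ _, 1, one_pos, by simp, Set.image_id _⟩, ?_, ?_⟩
    · rintro L M ⟨σ, α, hα, h, hL⟩
      refine ⟨σ.symm, α⁻¹, inv_pos.2 hα, fun x y => ?_, ?_⟩
      · have := h (σ.symm x) (σ.symm y)
        simp only [LinearEquiv.apply_symm_apply] at this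
        rw [this, inv_mul_cancel_left₀ hα.ne']
      · rw [← hL, ← Set.image_comp]
        simp
    · rintro L M N ⟨σ, α, hα, h, hL⟩ ⟨τ, β, hβ, h', hM⟩
      refine ⟨σ.trans τ, β * α, mul_pos hβ hα, fun x y => ?_, ?_⟩
      · simp [h, h', mul_assoc]
      · rw [← hM, ← hL, ← Set.image_comp]
        rfl

/-- The space of similarity classes of lattices, with the quotient topology. -/
abbrev SimilarityClass (n : ℕ) : Type := Quotient (similarSetoid n)

theorem minimum_of_similar {L M : EuclideanLattice n}
    {σ : EuclideanSpace ℝ (Fin n) ≃ₗ[ℝ] EuclideanSpace ℝ (Fin n)} {α : ℝ} (hα : 0 < α)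
    (h : ∀ x y, ⟪σ x, σ y⟫ = α * ⟪x, y⟫)
    (hL : σ '' (L.carrier : Set (EuclideanSpace ℝ (Fin n))) = M.carrier) :
    M.minimum = α * L.minimum := by
  unfold minimum
  rw [← smul_eq_mul, ← Real.sInf_smul_of_nonneg hα.le]
  congr 1
  ext r
  simp only [Set.mem_smul_set, Set.mem_ofPred_eq, smul_eq_mul]
  constructor
  · rintro ⟨y, hy, hy0, rfl⟩
    rw [← SetLike.mem_coe, ← hL] at hy
    obtain ⟨x, hx, rfl⟩ := hy
    exact ⟨_, ⟨x, hx, fun h0 => hy0 (by simp [h0]), rfl⟩, (h x x).symm⟩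
  · rintro ⟨_, ⟨x, hx, hx0, rfl⟩, rfl⟩
    refine ⟨σ x, ?_, by simpa using hx0, h x x⟩
    rw [← SetLike.mem_coe, ← hL]
    exact ⟨x, hx, rfl⟩

theorem det_sq_of_similarity
    {σ : EuclideanSpace ℝ (Fin n) ≃ₗ[ℝ] EuclideanSpace ℝ (Fin n)} {α : ℝ}
    (h : ∀ x y, ⟪σ x, σ y⟫ = α * ⟪x, y⟫) :
    LinearMap.det (σ : EuclideanSpace ℝ (Fin n) →ₗ[ℝ] EuclideanSpace ℝ (Fin n)) ^ 2 = α ^ n := by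
  set e := EuclideanSpace.basisFun (Fin n) ℝ
  rw [← LinearMap.det_toMatrix e.toBasis]
  set A := LinearMap.toMatrix e.toBasis e.toBasis
    (σ : EuclideanSpace ℝ (Fin n) →ₗ[ℝ] EuclideanSpace ℝ (Fin n)) with hA
  have hmul : A.transpose * A = α • (1 : Matrix (Fin n) (Fin n) ℝ) := by
    ext i j
    have h1 := h (e i) (e j)
    rw [← OrthonormalBasis.sum_inner_mul_inner e, orthonormal_iff_ite.1 e.orthonormal] at h1
    simp only [Matrix.mul_apply, Matrix.transpose_apply, Matrix.smul_apply, Matrix.one_apply,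
      smul_eq_mul]
    rw [← h1]
    refine Finset.sum_congr rfl fun k _ => ?_
    simp [hA, LinearMap.toMatrix_apply, OrthonormalBasis.repr_apply_apply, real_inner_comm]
  have := congrArg Matrix.det hmul
  rw [Matrix.det_mul, Matrix.det_transpose, Matrix.det_smul] at this
  simpa [sq] using this

theorem det_of_similar {L M : EuclideanLattice n}
    {σ : EuclideanSpace ℝ (Fin n) ≃ₗ[ℝ] EuclideanSpace ℝ (Fin n)} {α : ℝ}
    (h : ∀ x y, ⟪σ x, σ y⟫ = α * ⟪x, y⟫)
    (hL : σ '' (L.carrier : Set (EuclideanSpace ℝ (Fin n))) = M.carrier) :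
    M.det = α ^ n * L.det := by
  have hM : L.carrier.map
      (σ.restrictScalars ℤ : EuclideanSpace ℝ (Fin n) →ₗ[ℤ] EuclideanSpace ℝ (Fin n)) =
      M.carrier := SetLike.coe_injective hL
  let f : L.carrier ≃ₗ[ℤ] M.carrier :=
    ((σ.restrictScalars ℤ).submoduleMap L.carrier).trans (LinearEquiv.ofEq _ _ hM)
  have hf : ∀ x, ((f x : M.carrier) : EuclideanSpace ℝ (Fin n)) = σ x := fun x => rfl
  let c := Module.Free.chooseBasis ℤ L.carrier
  let b := c.reindex (c.indexEquiv c)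
  classical
  let b₀ := b.ofZLatticeBasis ℝ L.carrier
  have hb : ((↑) ∘ (b.map f) : _ → EuclideanSpace ℝ (Fin n)) =
      (σ : EuclideanSpace ℝ (Fin n) →ₗ[ℝ] EuclideanSpace ℝ (Fin n)) ∘ ((↑) ∘ b) := by
    ext1 i
    simp [hf]
  unfold det
  rw [ZLattice.covolume_eq_det_mul_measureReal M.carrier volume (b.map f) b₀,
    ZLattice.covolume_eq_det_mul_measureReal L.carrier volume b b₀, hb, Module.Basis.det_comp,
    abs_mul, mul_assoc, mul_pow, sq_abs, det_sq_of_similarity h]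

/-- The Hermite function is constant on similarity classes. -/
theorem hermite_eq_of_similar {L M : EuclideanLattice n} (h : L ≈ M) :
    L.hermite = M.hermite := by
  obtain ⟨σ, α, hα, h, hL⟩ := h
  unfold hermite
  rw [minimum_of_similar hα h hL, det_of_similar h hL]
  have hd : 0 ≤ L.det := sq_nonneg _
  rcases Nat.eq_zero_or_pos n with rfl | hn
  · have : L.minimum = 0 := by
      have : {r : ℝ | ∃ x ∈ L.carrier, x ≠ 0 ∧ ⟪x, x⟫ = r} = ∅ := by
        ext r
        simp only [Set.mem_ofPred_eq, Set.mem_empty_iff_false, iff_false]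
        rintro ⟨x, -, hx, -⟩
        exact hx (Subsingleton.elim _ _)
      rw [minimum, this, Real.sInf_empty]
    simp [this]
  · rw [Real.mul_rpow (pow_nonneg hα.le n) hd, one_div, Real.pow_rpow_inv_natCast hα.le hn.ne',
      mul_div_mul_left _ _ hα.ne']

/-- The Hermite function on the space of similarity classes. -/
def hermiteClass : SimilarityClass n → ℝ :=
  Quotient.lift hermite fun _ _ => hermite_eq_of_similar

/-- `L` is extreme if its similarity class realises a local maximum of the Hermite function. -/
def IsExtreme (L : EuclideanLattice n) : Prop :=
  IsLocalMax (hermiteClass (n := n)) (Quotient.mk (similarSetoid n) L)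

/-! ### Perfect and strongly eutactic lattices -/

/-- The matrix `x xᵀ`. -/
def outer (x : EuclideanSpace ℝ (Fin n)) : Matrix (Fin n) (Fin n) ℝ :=
  Matrix.vecMulVec x.ofLp x.ofLp

/-- `L` is perfect if the matrices `x xᵀ`, `x ∈ Min(L)`, span the space of symmetric matrices. -/
def IsPerfect (L : EuclideanLattice n) : Prop :=
  (Submodule.span ℝ (outer '' (L.minVectors : Set (EuclideanSpace ℝ (Fin n)))) :
    Set (Matrix (Fin n) (Fin n) ℝ)) = {A | A.IsSymm}

/-- `L` is strongly eutactic if the identity matrix is a combination of the `x xᵀ`,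
`x ∈ Min(L)`, with all coefficients equal to one positive number. -/
def IsStronglyEutactic (L : EuclideanLattice n) : Prop :=
  ∃ c : ℝ, 0 < c ∧ (1 : Matrix (Fin n) (Fin n) ℝ) = ∑ x ∈ L.minVectors, c • outer x

end EuclideanLattice

/-! ### Spherical designs -/

/-- The mean value of a polynomial over the sphere `{x ∈ ℝⁿ | (x, x) = m}`, with respect to the
rotation invariant measure of total mass one; it is transported from the unit sphere. -/
def sphereMean {n : ℕ} (m : ℝ) (p : MvPolynomial (Fin n) ℝ) : ℝ :=
  ⨍ u : Metric.sphere (0 : EuclideanSpace ℝ (Fin n)) 1,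
    MvPolynomial.eval (fun i => Real.sqrt m * (u : EuclideanSpace ℝ (Fin n)) i) p
    ∂(volume : Measure (EuclideanSpace ℝ (Fin n))).toSphere

/-- `X` is a spherical `t`-design on the sphere `{x ∈ ℝⁿ | (x, x) = m}`. -/
def IsSphericalDesign {n : ℕ} (t : ℕ) (m : ℝ) (X : Finset (EuclideanSpace ℝ (Fin n))) : Prop :=
  X.Nonempty ∧ (∀ x ∈ X, ⟪x, x⟫ = m) ∧
    ∀ p : MvPolynomial (Fin n) ℝ, p.totalDegree ≤ t →
      (1 / (X.card : ℝ)) * ∑ x ∈ X, MvPolynomial.eval (fun i => x i) p = sphereMean m p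

/-- `L` is strongly perfect if its minimal vectors form a spherical `4`-design. -/
def EuclideanLattice.IsStronglyPerfect {n : ℕ} (L : EuclideanLattice n) : Prop :=
  IsSphericalDesign 4 L.minimum L.minVectors

end

/-! The design property is tested only on squares of forms, so no spherical integral is ever
computed. For the degree 2 polynomial `(a,x)²`, rotation invariance shows that its sum over `Min(L)`
depends only on the norm of `a`; polarising over the standard basis makes the second moment matrix a
positive scalar, which is strong eutaxy. For a quadratic form vanishing on `Min(L)`, its square has
degree 4 and mean zero on the sphere, so the form is zero; by duality this is perfection.

Extremality follows from Voronoi's argument. A nearby lattice is `σ(L)`, with Gram form `Q = σᵀσ`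
close to the identity. Scale `Q` to determinant 1 and write it as `1 + H`. If `H` were positive on
all of `Min(L)`, eutaxy would make `tr H` a positive multiple of the sum of its values there, and
perfection would bound `‖H‖` by that sum. The first-order term of the determinant would then
dominate, giving `det(1 + H) > 1`, a contradiction (`eventually_one_lt_det`,
`eventually_exists_quad_le`). It remains to pass from bases to similarity classes
(`isExtreme_of_eventually_hermite_le`). -/

/-! ### Second moments of spherical designs -/

section Sphere

open scoped Pointwise

variable {E : Type*} [NormedAddCommGroup E] [InnerProductSpace ℝ E]

/-- The self-map of the unit sphere induced by a linear isometry. -/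
def LinearIsometryEquiv.onSphere (g : E ≃ₗᵢ[ℝ] E) (u : Metric.sphere (0 : E) 1) :
    Metric.sphere (0 : E) 1 :=
  ⟨g u, by simp⟩

variable [FiniteDimensional ℝ E] [MeasurableSpace E] [BorelSpace E]

/-- Up to a constant factor, `toSphere` measures a set by the volume of the cone `(0,1) • s`; a
linear isometry preserves volume and commutes with taking cones. -/
theorem LinearIsometryEquiv.measurePreserving_onSphere (g : E ≃ₗᵢ[ℝ] E) :
    MeasurePreserving g.onSphere (volume : Measure E).toSphere (volume : Measure E).toSphere := by
  have hm : Measurable g.onSphere :=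
    (Continuous.subtype_mk (g.continuous.comp continuous_subtype_val) _).measurable
  refine ⟨hm, Measure.ext fun s hs => ?_⟩
  rw [Measure.map_apply hm hs, Measure.toSphere_apply' _ (hm hs), Measure.toSphere_apply' _ hs]
  have hg : MeasurePreserving g.toMeasurableEquiv := g.measurePreserving
  rw [← hg.measure_preimage_equiv (Set.Ioo (0 : ℝ) 1 • (Subtype.val '' s))]
  congr 2
  ext x
  simp only [Set.mem_smul, Set.mem_preimage, Set.mem_image,
    LinearIsometryEquiv.coe_toMeasurableEquiv]
  constructor
  · rintro ⟨r, hr, _, ⟨u, hu, rfl⟩, rfl⟩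
    exact ⟨r, hr, _, ⟨_, hu, rfl⟩, (g.map_smul r (u : E)).symm⟩
  · rintro ⟨r, hr, _, ⟨u, hu, rfl⟩, h⟩
    refine ⟨r, hr, _, ⟨g.symm.onSphere u, ?_, rfl⟩, ?_⟩
    · simpa [LinearIsometryEquiv.onSphere] using hu
    · apply g.injective
      simpa [LinearIsometryEquiv.onSphere] using h

theorem LinearIsometryEquiv.average_toSphere_comp (g : E ≃ₗᵢ[ℝ] E) {f : E → ℝ}
    (hf : Continuous f) :
    ⨍ u : Metric.sphere (0 : E) 1, f (g u) ∂(volume : Measure E).toSphere =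
      ⨍ u : Metric.sphere (0 : E) 1, f u ∂(volume : Measure E).toSphere := by
  rw [average_eq, average_eq]
  congr 1
  have h := g.measurePreserving_onSphere
  have h2 := integral_map (μ := (volume : Measure E).toSphere) h.measurable.aemeasurable
    (f := fun u : Metric.sphere (0 : E) 1 => f u)
    (hf.comp continuous_subtype_val).aestronglyMeasurable
  rw [h.map_eq] at h2
  exact h2.symm

end Sphere

section Design

open MvPolynomial

variable {n : ℕ}

theorem sphereMean_eq_of_eval {m : ℝ} {p : MvPolynomial (Fin n) ℝ}
    {f : EuclideanSpace ℝ (Fin n) → ℝ} (h : ∀ x, eval (fun i => x i) p = f x) :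
    sphereMean m p = ⨍ u : Metric.sphere (0 : EuclideanSpace ℝ (Fin n)) 1,
      f (Real.sqrt m • (u : EuclideanSpace ℝ (Fin n)))
      ∂(volume : Measure (EuclideanSpace ℝ (Fin n))).toSphere := by
  simp only [sphereMean, ← h]
  rfl

/-- A linear form as a polynomial. -/
noncomputable def linearFormPoly (a : EuclideanSpace ℝ (Fin n)) : MvPolynomial (Fin n) ℝ :=
  ∑ i, C (a i) * X i

theorem eval_linearFormPoly (a x : EuclideanSpace ℝ (Fin n)) :
    eval (fun i => x i) (linearFormPoly a) = ⟪a, x⟫ := by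
  simp [linearFormPoly, PiLp.inner_apply, mul_comm]

theorem totalDegree_linearFormPoly_le (a : EuclideanSpace ℝ (Fin n)) :
    (linearFormPoly a).totalDegree ≤ 1 := by
  refine totalDegree_finsetSum_le fun i _ => (totalDegree_mul _ _).trans ?_
  simp

/-- A quadratic form as a polynomial. -/
noncomputable def quadraticFormPoly (F : Matrix (Fin n) (Fin n) ℝ) : MvPolynomial (Fin n) ℝ :=
  ∑ i, ∑ j, C (F i j) * X i * X j

theorem eval_quadraticFormPoly (F : Matrix (Fin n) (Fin n) ℝ) (x : EuclideanSpace ℝ (Fin n)) :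
    eval (fun i => x i) (quadraticFormPoly F) = ∑ i, ∑ j, F i j * x i * x j := by
  simp [quadraticFormPoly]

theorem totalDegree_quadraticFormPoly_le (F : Matrix (Fin n) (Fin n) ℝ) :
    (quadraticFormPoly F).totalDegree ≤ 2 := by
  refine totalDegree_finsetSum_le fun i _ => totalDegree_finsetSum_le fun j _ =>
    (totalDegree_mul _ _).trans ?_
  have := totalDegree_mul (C (F i j)) (X i : MvPolynomial (Fin n) ℝ)
  simp only [totalDegree_C, totalDegree_X] at this ⊢
  omega

/-- Both sums are multiples of spherical means, and the reflection in the hyperplane orthogonal to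
`a - b` carries `a` to `b` while preserving the measure. -/
theorem IsSphericalDesign.sum_inner_sq_eq {t : ℕ} (ht : 2 ≤ t) {m : ℝ}
    {X : Finset (EuclideanSpace ℝ (Fin n))} (hX : IsSphericalDesign t m X)
    {a b : EuclideanSpace ℝ (Fin n)} (hab : ‖a‖ = ‖b‖) :
    ∑ x ∈ X, ⟪a, x⟫ ^ 2 = ∑ x ∈ X, ⟪b, x⟫ ^ 2 := by
  have hs : (0 : ℝ) < X.card := by exact_mod_cast hX.1.card_pos
  have key : ∀ c : EuclideanSpace ℝ (Fin n), (1 / (X.card : ℝ)) * ∑ x ∈ X, ⟪c, x⟫ ^ 2 =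
      ⨍ u : Metric.sphere (0 : EuclideanSpace ℝ (Fin n)) 1,
        ⟪c, Real.sqrt m • (u : EuclideanSpace ℝ (Fin n))⟫ ^ 2
        ∂(volume : Measure (EuclideanSpace ℝ (Fin n))).toSphere := by
    intro c
    have hdeg : (linearFormPoly c ^ 2).totalDegree ≤ t := by
      refine ((totalDegree_pow _ _).trans ?_).trans ht
      have := totalDegree_linearFormPoly_le c
      omega
    have h := hX.2.2 _ hdeg
    rw [sphereMean_eq_of_eval (f := fun x => ⟪c, x⟫ ^ 2)
      (fun x => by rw [map_pow, eval_linearFormPoly])] at h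
    simpa only [map_pow, eval_linearFormPoly] using h
  let g : EuclideanSpace ℝ (Fin n) ≃ₗᵢ[ℝ] EuclideanSpace ℝ (Fin n) :=
    (ℝ ∙ (a - b))ᗮ.reflection
  have hg : g a = b := Submodule.reflection_sub hab
  have h1 := g.average_toSphere_comp
    (f := fun x => ⟪b, Real.sqrt m • x⟫ ^ 2) (by fun_prop)
  simp only [← hg, ← map_smul, LinearIsometryEquiv.inner_map_map] at h1
  rw [hg, ← key, ← key] at h1
  exact mul_left_cancel₀ (by positivity) h1

/-- The square of the form is continuous and nonnegative with mean zero, hence vanishes on the whole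
sphere; homogeneity extends this to every vector. -/
theorem IsSphericalDesign.quadratic_eq_zero {m : ℝ} (hm : 0 < m)
    {X : Finset (EuclideanSpace ℝ (Fin n))} (hX : IsSphericalDesign 4 m X)
    {F : Matrix (Fin n) (Fin n) ℝ} (hF : ∀ x ∈ X, ∑ i, ∑ j, F i j * x i * x j = 0)
    (v : EuclideanSpace ℝ (Fin n)) : ∑ i, ∑ j, F i j * v i * v j = 0 := by
  set q : EuclideanSpace ℝ (Fin n) → ℝ := fun x => ∑ i, ∑ j, F i j * x i * x j with hq
  have hqs : ∀ (r : ℝ) x, q (r • x) = r ^ 2 * q x := by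
    intro r x
    simp only [hq, Finset.mul_sum]
    refine Finset.sum_congr rfl fun i _ => Finset.sum_congr rfl fun j _ => ?_
    simp only [PiLp.smul_apply, smul_eq_mul]
    ring
  have hqc : Continuous q := by simp only [hq]; fun_prop
  have hdeg : (quadraticFormPoly F ^ 2).totalDegree ≤ 4 := by
    refine (totalDegree_pow _ _).trans ?_
    have := totalDegree_quadraticFormPoly_le F
    omega
  have h := hX.2.2 _ hdeg
  rw [sphereMean_eq_of_eval (f := fun x => q x ^ 2)
    (fun x => by rw [map_pow, eval_quadraticFormPoly])] at h
  simp only [map_pow, eval_quadraticFormPoly] at h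
  rw [Finset.sum_eq_zero (fun x hx => by rw [hF x hx]; norm_num), mul_zero] at h
  -- A nonzero `v` makes the space nontrivial, so the sphere has nonzero measure; otherwise a zero
  -- average would say nothing about the integral.
  by_cases hv : v = 0
  · simp [hv]
  have : Nontrivial (EuclideanSpace ℝ (Fin n)) := ⟨v, 0, hv⟩
  let μ := (volume : Measure (EuclideanSpace ℝ (Fin n))).toSphere
  have hc : Continuous fun u : Metric.sphere (0 : EuclideanSpace ℝ (Fin n)) 1 =>
      q (Real.sqrt m • (u : EuclideanSpace ℝ (Fin n))) ^ 2 := by fun_prop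
  have hint : ∫ u, q (Real.sqrt m • ((u : Metric.sphere (0 : EuclideanSpace ℝ (Fin n)) 1) :
      EuclideanSpace ℝ (Fin n))) ^ 2 ∂μ = 0 := by
    rw [average_eq, eq_comm, smul_eq_zero] at h
    refine h.resolve_left (inv_ne_zero ?_)
    rw [measureReal_ne_zero_iff (measure_ne_top _ _), Ne, Measure.measure_univ_eq_zero]
    exact Measure.toSphere_ne_zero _
  have hz := (hc.ae_eq_iff_eq μ continuous_zero).1
    ((integral_eq_zero_iff_of_nonneg (μ := μ) (fun u => sq_nonneg _)
      (hc.integrable_of_hasCompactSupport (HasCompactSupport.of_compactSpace _))).1 hint)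
  have hu := congrFun hz ⟨‖v‖⁻¹ • v, by simp [norm_smul, hv]⟩
  simp only [hqs, Pi.zero_apply] at hu
  have hv' : ‖v‖ ≠ 0 := norm_ne_zero_iff.2 hv
  have : Real.sqrt m ≠ 0 := (Real.sqrt_pos.2 hm).ne'
  simpa [hv', hm.ne', this] using hu

end Design

/-! ### Strong eutaxy and perfection from the design property -/

namespace EuclideanLattice

variable {n : ℕ}

theorem exists_ne_zero (hn : 1 ≤ n) (L : EuclideanLattice n) : ∃ x ∈ L.carrier, x ≠ 0 := by
  by_contra! h
  have hbot : L.carrier = ⊥ := (Submodule.eq_bot_iff _).2 h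
  have hs := L.isZLattice.span_top
  rw [hbot] at hs
  have : Nontrivial (EuclideanSpace ℝ (Fin n)) := by
    have : Nonempty (Fin n) := ⟨⟨0, hn⟩⟩
    infer_instance
  simp at hs

theorem bddBelow_inner_self (L : EuclideanLattice n) :
    BddBelow {r : ℝ | ∃ x ∈ L.carrier, x ≠ 0 ∧ ⟪x, x⟫ = r} :=
  ⟨0, by rintro _ ⟨x, -, -, rfl⟩; exact real_inner_self_nonneg⟩

theorem minimum_le (L : EuclideanLattice n) {x : EuclideanSpace ℝ (Fin n)}
    (hx : x ∈ L.carrier) (h0 : x ≠ 0) : L.minimum ≤ ⟪x, x⟫ :=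
  csInf_le L.bddBelow_inner_self ⟨x, hx, h0, rfl⟩

theorem minimum_pos (hn : 1 ≤ n) (L : EuclideanLattice n) : 0 < L.minimum := by
  obtain ⟨x, hx, hx0⟩ := L.exists_ne_zero hn
  obtain ⟨ε, hε, h⟩ := Metric.exists_ball_inter_eq_singleton_of_mem_discrete
    (s := (L.carrier : Set (EuclideanSpace ℝ (Fin n)))) ⟨L.discrete⟩ L.carrier.zero_mem
  refine lt_of_lt_of_le (pow_pos hε 2) (le_csInf ⟨_, x, hx, hx0, rfl⟩ ?_)
  rintro _ ⟨y, hy, hy0, rfl⟩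
  rw [real_inner_self_eq_norm_sq]
  gcongr
  by_contra! hlt
  have : y ∈ Metric.ball (0 : EuclideanSpace ℝ (Fin n)) ε ∩ L.carrier := ⟨by simpa using hlt, hy⟩
  rw [h] at this
  exact hy0 this

theorem outer_apply (x : EuclideanSpace ℝ (Fin n)) (i j : Fin n) : outer x i j = x i * x j := rfl

theorem isSymm_outer (x : EuclideanSpace ℝ (Fin n)) : (outer x).IsSymm := by
  ext i j
  simp [outer_apply, mul_comm]

theorem IsStronglyPerfect.isStronglyEutactic (hn : 1 ≤ n) {L : EuclideanLattice n}
    (hL : L.IsStronglyPerfect) : L.IsStronglyEutactic := by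
  have hm := L.minimum_pos hn
  let e : Fin n → EuclideanSpace ℝ (Fin n) := fun i => EuclideanSpace.single i 1
  have he : ∀ i x, ⟪e i, x⟫ = x i := fun i x => by simp [e, EuclideanSpace.inner_single_left]
  have hdiag : ∀ i j : Fin n, ∑ x ∈ L.minVectors, x i ^ 2 = ∑ x ∈ L.minVectors, x j ^ 2 := by
    intro i j
    have := hL.sum_inner_sq_eq (by norm_num) (a := e i) (b := e j) (by simp [e])
    simpa only [he] using this
  -- Polarisation: `e i + e j` and `e i - e j` have equal norm, and their squared linear forms
  -- differ by `4 * x i * x j`.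
  have hoff : ∀ i j : Fin n, i ≠ j → ∑ x ∈ L.minVectors, x i * x j = 0 := by
    intro i j hij
    have hnorm : ‖e i + e j‖ = ‖e i - e j‖ := by
      rw [← sq_eq_sq₀ (norm_nonneg _) (norm_nonneg _), norm_add_sq_real, norm_sub_sq_real, he]
      simp [e, hij]
    have := hL.sum_inner_sq_eq (by norm_num) hnorm
    simp only [inner_add_left, inner_sub_left, he] at this
    rw [← sub_eq_zero, ← Finset.sum_sub_distrib] at this
    have h4 : (4 : ℝ) * ∑ x ∈ L.minVectors, x i * x j = 0 := by
      rw [Finset.mul_sum, ← this]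
      exact Finset.sum_congr rfl fun x _ => by ring
    linarith
  let i₀ : Fin n := ⟨0, hn⟩
  set c := ∑ x ∈ L.minVectors, x i₀ ^ 2 with hc
  -- The trace of the second moment matrix, computed in two ways; it gives `c > 0`.
  have hsum : n * c = L.minVectors.card * L.minimum := by
    have h1 : ∑ i : Fin n, ∑ x ∈ L.minVectors, x i ^ 2 = n * c := by
      rw [Finset.sum_congr rfl fun i _ => hdiag i i₀]
      simp [hc]
    rw [← h1, Finset.sum_comm, Finset.sum_congr rfl (g := fun _ => L.minimum), Finset.sum_const,
      nsmul_eq_mul]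
    intro x hx
    rw [← (mem_minVectors.1 hx).2, real_inner_self_eq_norm_sq, EuclideanSpace.real_norm_sq_eq]
  have hcpos : 0 < c := by
    have h1 : (0 : ℝ) < L.minVectors.card := by exact_mod_cast hL.1.card_pos
    have h2 : 0 < (n : ℝ) * c := by rw [hsum]; positivity
    exact pos_of_mul_pos_right h2 (Nat.cast_nonneg n)
  refine ⟨c⁻¹, inv_pos.2 hcpos, ?_⟩
  ext i j
  rw [← Finset.smul_sum, Matrix.smul_apply, Matrix.sum_apply]
  simp only [outer_apply, smul_eq_mul]
  by_cases hij : i = j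
  · subst hij
    simp only [← sq, Matrix.one_apply_eq]
    rw [hdiag i i₀, inv_mul_cancel₀ hcpos.ne']
  · rw [hoff i j hij, mul_zero, Matrix.one_apply_ne hij]

/-- By duality, a symmetric matrix outside the span is separated from it by a functional `f` that
kills the span. Then `v ↦ f (outer v)` is a quadratic form vanishing on `Min(L)`, hence everywhere,
so `f` kills all symmetric matrices. -/
theorem IsStronglyPerfect.isPerfect (hn : 1 ≤ n) {L : EuclideanLattice n}
    (hL : L.IsStronglyPerfect) : L.IsPerfect := by
  have hm := L.minimum_pos hn
  ext A
  simp only [SetLike.mem_coe, Set.mem_ofPred_eq]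
  constructor
  · intro hA
    induction hA using Submodule.span_induction with
    | mem _ h =>
      obtain ⟨x, -, rfl⟩ := h
      exact isSymm_outer x
    | zero => exact Matrix.isSymm_zero
    | add _ _ _ _ h1 h2 => exact h1.add h2
    | smul r _ _ h => exact h.smul r
  · intro hA
    by_contra hA'
    obtain ⟨f, hfA, hf⟩ := Submodule.exists_le_ker_of_notMem hA'
    have hfM : ∀ M, f M = ∑ i, ∑ j, f (Matrix.single i j 1) * M i j := by
      intro M
      conv_lhs => rw [Matrix.matrix_eq_sum_single M]
      simp only [map_sum]
      refine Finset.sum_congr rfl fun i _ => Finset.sum_congr rfl fun j _ => ?_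
      rw [← mul_one (M i j), ← smul_eq_mul, ← Matrix.smul_single, map_smul]
      simp [mul_comm]
    have hq : ∀ v : EuclideanSpace ℝ (Fin n), f (outer v) = 0 := by
      have h0 := IsSphericalDesign.quadratic_eq_zero hm hL
        (F := Matrix.of fun i j => f (Matrix.single i j 1)) ?_
      · intro v
        rw [hfM, ← h0 v]
        simp [outer_apply, mul_assoc]
      · intro x hx
        have : f (outer x) = 0 := hf (Submodule.subset_span ⟨x, hx, rfl⟩)
        rw [← this, hfM]
        simp [outer_apply, mul_assoc]
    -- The coefficients of `f` need not be symmetric, so only their symmetric part is determined;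
    -- pairing with the symmetric `A` sees nothing else.
    have hpol : ∀ i j, f (Matrix.single i j 1) + f (Matrix.single j i 1) = 0 := by
      intro i j
      have hs : Matrix.single i j (1 : ℝ) + Matrix.single j i 1 =
          outer (EuclideanSpace.single i 1 + EuclideanSpace.single j 1) -
          outer (EuclideanSpace.single i 1) - outer (EuclideanSpace.single j 1) := by
        have hsingle : ∀ i j k l : Fin n, Matrix.single i j (1 : ℝ) k l =
            EuclideanSpace.single i (1 : ℝ) k * EuclideanSpace.single j (1 : ℝ) l := by
          intro i j k l
          simp only [Matrix.single_apply, PiLp.single_apply, eq_comm (a := i), eq_comm (a := j),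
            ite_and, mul_ite, mul_one, mul_zero]
          split_ifs <;> rfl
        ext k l
        simp only [Matrix.add_apply, Matrix.sub_apply, hsingle, outer_apply, PiLp.add_apply]
        ring
      rw [← map_add, hs]
      simp [hq]
    apply hfA
    have h1 := hfM A
    have h2 : f A = ∑ i, ∑ j, f (Matrix.single j i 1) * A i j := by
      rw [h1, Finset.sum_comm]
      exact Finset.sum_congr rfl fun i _ => Finset.sum_congr rfl fun j _ => by rw [hA.apply]
    have h3 : f A + f A = 0 := by
      nth_rewrite 1 [h1]
      rw [h2, ← Finset.sum_add_distrib]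
      refine Finset.sum_eq_zero fun i _ => ?_
      rw [← Finset.sum_add_distrib]
      exact Finset.sum_eq_zero fun j _ => by rw [← add_mul, hpol, zero_mul]
    linarith

end EuclideanLattice

/-! ### Perfect and strongly eutactic lattices are extreme: the local estimate -/

section Det

open Filter Topology

variable {n : ℕ}

/-- Differentiability holds because the determinant is polynomial in the entries; the derivative is
then identified along each line `t • H`, where the linear coefficient is the trace. -/
theorem hasFDerivAt_det_one_add :
    ∃ f : (Fin n → Fin n → ℝ) →L[ℝ] ℝ, (∀ H, f H = Matrix.trace (Matrix.of H)) ∧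
      HasFDerivAt (fun H : Fin n → Fin n → ℝ => (1 + Matrix.of H).det) f 0 := by
  have hd : DifferentiableAt ℝ (fun H : Fin n → Fin n → ℝ => (1 + Matrix.of H).det) 0 := by
    simp only [Matrix.det_apply, Matrix.add_apply, Matrix.of_apply]
    fun_prop
  refine ⟨_, fun H => ?_, hd.hasFDerivAt⟩
  have h1 : HasDerivAt (fun t : ℝ => t • H) H 0 := by
    simpa using (hasDerivAt_id (0 : ℝ)).smul_const H
  have hd' : HasFDerivAt (fun H : Fin n → Fin n → ℝ => (1 + Matrix.of H).det)
      (fderiv ℝ (fun H : Fin n → Fin n → ℝ => (1 + Matrix.of H).det) 0) ((0 : ℝ) • H) := by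
    rw [zero_smul]; exact hd.hasFDerivAt
  have h2 := hd'.comp_hasDerivAt (0 : ℝ) h1
  have h3 : HasDerivAt (fun t : ℝ => (1 + Matrix.of (t • H)).det)
      (Matrix.trace (Matrix.of H)) 0 := by
    -- `p` is what remains of the polynomial in `t` after its two lowest coefficients are split off.
    set p := (1 + (Polynomial.X : Polynomial ℝ) •
      (Matrix.of H).map Polynomial.C).det.divX.divX with hp
    have : (fun t : ℝ => (1 + Matrix.of (t • H)).det) =
        fun t => 1 + Matrix.trace (Matrix.of H) * t + p.eval t * t ^ 2 := by
      funext t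
      exact Matrix.det_one_add_smul t (Matrix.of H)
    rw [this]
    have := (((hasDerivAt_id (0 : ℝ)).const_mul (Matrix.trace (Matrix.of H))).const_add 1).add
      ((p.hasDerivAt 0).mul (hasDerivAt_pow 2 (0 : ℝ)))
    convert! this using 1
    simp
  exact h2.unique h3

end Det

namespace EuclideanLattice

open Filter Topology

variable {n : ℕ}

/-- The value `xᵀ H x`. -/
def quad (H : Fin n → Fin n → ℝ) (x : EuclideanSpace ℝ (Fin n)) : ℝ :=
  ∑ i, ∑ j, H i j * (x i * x j)

/-- `quad H x` is the entrywise pairing of `H` with `outer x`. So `H` is orthogonal to the span,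
which contains `H` itself. -/
theorem IsPerfect.eq_zero_of_quad_eq_zero {L : EuclideanLattice n} (hL : L.IsPerfect)
    {H : Fin n → Fin n → ℝ} (hH : ∀ i j, H i j = H j i)
    (h0 : ∀ x ∈ L.minVectors, quad H x = 0) : H = 0 := by
  have hspan : ∀ M ∈ Submodule.span ℝ (outer '' (L.minVectors : Set (EuclideanSpace ℝ (Fin n)))),
      ∑ i, ∑ j, H i j * M i j = 0 := by
    intro M hM
    induction hM using Submodule.span_induction with
    | mem _ h =>
      obtain ⟨x, hx, rfl⟩ := h
      exact h0 x hx
    | zero => simp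
    | add _ _ _ _ h1 h2 => simp [mul_add, Finset.sum_add_distrib, h1, h2]
    | smul r M _ h =>
      have : ∑ i, ∑ j, H i j * (r • M) i j = r * ∑ i, ∑ j, H i j * M i j := by
        simp only [Finset.mul_sum, Matrix.smul_apply, smul_eq_mul]
        exact Finset.sum_congr rfl fun i _ => Finset.sum_congr rfl fun j _ => by ring
      rw [this, h, mul_zero]
  have hmem : Matrix.of H ∈
      Submodule.span ℝ (outer '' (L.minVectors : Set (EuclideanSpace ℝ (Fin n)))) := by
    rw [← SetLike.mem_coe, hL]
    ext i j
    exact hH j i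
  have h := hspan _ hmem
  have hnn : ∀ i j, 0 ≤ H i j * Matrix.of H i j := fun i j => mul_self_nonneg _
  rw [Finset.sum_eq_zero_iff_of_nonneg fun i _ => Finset.sum_nonneg fun j _ => hnn i j] at h
  funext i j
  have hi := (Finset.sum_eq_zero_iff_of_nonneg fun j _ => hnn i j).1 (h i (Finset.mem_univ i))
    j (Finset.mem_univ j)
  exact mul_self_eq_zero.1 hi

/-- Quantitative perfection: evaluation on `Min(L)` is injective on symmetric matrices, and an
injective linear map from a finite-dimensional space is bounded below. -/
theorem IsPerfect.exists_norm_le {L : EuclideanLattice n} (hL : L.IsPerfect) :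
    ∃ K : ℝ, 0 < K ∧ ∀ H : Fin n → Fin n → ℝ, (∀ i j, H i j = H j i) →
      ‖H‖ ≤ K * ∑ x ∈ L.minVectors, |quad H x| := by
  let S : Submodule ℝ (Fin n → Fin n → ℝ) :=
    { carrier := {H | ∀ i j, H i j = H j i}
      add_mem' := fun h1 h2 i j => by simp [h1 i j, h2 i j]
      zero_mem' := fun i j => rfl
      smul_mem' := fun r H h i j => by simp [h i j] }
  let φ : S →ₗ[ℝ] (L.minVectors → ℝ) :=
    { toFun := fun H x => quad H.1 x.1
      map_add' := fun H₁ H₂ => by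
        funext x
        simp [quad, add_mul, Finset.sum_add_distrib]
      map_smul' := fun r H => by
        funext x
        simp [quad, Finset.mul_sum, mul_assoc] }
  have hφ : LinearMap.ker φ = ⊥ := by
    rw [LinearMap.ker_eq_bot']
    intro H h
    exact Subtype.ext (hL.eq_zero_of_quad_eq_zero H.2 fun x hx => congrFun h ⟨x, hx⟩)
  obtain ⟨K, hK, hφK⟩ := φ.exists_antilipschitzWith hφ
  refine ⟨K, hK, fun H hH => ?_⟩
  have h := hφK.le_mul_dist ⟨H, hH⟩ 0
  rw [map_zero, dist_zero_right, dist_zero_right] at h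
  refine h.trans (mul_le_mul_of_nonneg_left ?_ K.2)
  refine (pi_norm_le_iff_of_nonneg (Finset.sum_nonneg fun _ _ => abs_nonneg _)).2 fun x => ?_
  exact Finset.single_le_sum (f := fun x => |quad H x|) (fun _ _ => abs_nonneg _) x.2

/-- Pair the eutaxy relation with `H`. -/
theorem IsStronglyEutactic.exists_trace_eq {L : EuclideanLattice n} (hL : L.IsStronglyEutactic) :
    ∃ c : ℝ, 0 < c ∧ ∀ H : Fin n → Fin n → ℝ,
      Matrix.trace (Matrix.of H) = c * ∑ x ∈ L.minVectors, quad H x := by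
  obtain ⟨c, hc, h⟩ := hL
  refine ⟨c, hc, fun H => ?_⟩
  have h1 : Matrix.trace (Matrix.of H) =
      ∑ i, ∑ j, H i j * (1 : Matrix (Fin n) (Fin n) ℝ) i j := by
    simp [Matrix.trace, Matrix.one_apply]
  rw [h1, h]
  simp only [quad, Matrix.sum_apply, Matrix.smul_apply, smul_eq_mul, Finset.mul_sum, outer_apply]
  rw [Finset.sum_congr rfl fun i _ => Finset.sum_comm, Finset.sum_comm]
  exact Finset.sum_congr rfl fun x _ => Finset.sum_congr rfl fun i _ =>
    Finset.sum_congr rfl fun j _ => by ring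

/-- The determinant exceeds `1` at a small perturbation `1 + H` of the identity, if `H` is
positive on the minimal vectors of a perfect and strongly eutactic lattice. -/
theorem IsPerfect.eventually_one_lt_det {L : EuclideanLattice n} (hL : L.IsPerfect)
    (hL' : L.IsStronglyEutactic) (hne : L.minVectors.Nonempty) :
    ∀ᶠ H : Fin n → Fin n → ℝ in 𝓝 0, (∀ i j, H i j = H j i) →
      (∀ x ∈ L.minVectors, 0 < quad H x) → 1 < (1 + Matrix.of H).det := by
  obtain ⟨K, hK, hKH⟩ := hL.exists_norm_le
  obtain ⟨c, hc, htr⟩ := hL'.exists_trace_eq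
  obtain ⟨f, hf, hdet⟩ := hasFDerivAt_det_one_add (n := n)
  -- With this constant the remainder is at most half of the trace term `c * ∑ quad H x`.
  have hlit := hdet.isLittleO.def (c := c / (2 * K)) (by positivity)
  filter_upwards [hlit] with H hH hsymm hpos
  have hs : 0 < ∑ x ∈ L.minVectors, quad H x := Finset.sum_pos hpos hne
  have hn := hKH H hsymm
  rw [Finset.sum_congr rfl fun x hx => abs_of_pos (hpos x hx)] at hn
  have h0 : (1 + Matrix.of (0 : Fin n → Fin n → ℝ)).det = 1 := by
    have : Matrix.of (0 : Fin n → Fin n → ℝ) = 0 := rfl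
    simp [this]
  rw [h0, sub_zero, hf, htr, Real.norm_eq_abs] at hH
  have h1 := (abs_le.1 hH).1
  have h2 : c / (2 * K) * ‖H‖ ≤ c / 2 * ∑ x ∈ L.minVectors, quad H x := by
    calc c / (2 * K) * ‖H‖ ≤ c / (2 * K) * (K * ∑ x ∈ L.minVectors, quad H x) := by gcongr
      _ = _ := by field_simp
  nlinarith [mul_pos hc hs]

theorem quad_one (x : EuclideanSpace ℝ (Fin n)) :
    quad (1 : Matrix (Fin n) (Fin n) ℝ) x = ⟪x, x⟫ := by
  rw [real_inner_self_eq_norm_sq, EuclideanSpace.real_norm_sq_eq]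
  simp [quad, Matrix.one_apply, sq]

/-- Apply the determinant estimate to `H = Q / det(Q)^(1/n) - 1`. If the bound failed at every
minimal vector, `H` would be positive on all of them, although `1 + H` has determinant exactly 1. -/
theorem IsPerfect.eventually_exists_quad_le (hn : 1 ≤ n) {L : EuclideanLattice n}
    (hL : L.IsPerfect) (hL' : L.IsStronglyEutactic) (hne : L.minVectors.Nonempty) :
    ∀ᶠ Q : Matrix (Fin n) (Fin n) ℝ in 𝓝 1, Q.IsSymm →
      ∃ x ∈ L.minVectors, quad Q x ≤ L.minimum * Q.det ^ (1 / (n : ℝ)) := by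
  have hcont : Tendsto (fun Q : Matrix (Fin n) (Fin n) ℝ =>
      ((Q.det ^ (1 / (n : ℝ)))⁻¹ • Q - 1 : Matrix (Fin n) (Fin n) ℝ)) (𝓝 1) (𝓝 0) := by
    have hdet : Tendsto (fun Q : Matrix (Fin n) (Fin n) ℝ => Q.det) (𝓝 1) (𝓝 1) := by
      have : Continuous fun Q : Matrix (Fin n) (Fin n) ℝ => Q.det := continuous_id.matrix_det
      simpa using this.tendsto 1
    have h1 := (hdet.rpow_const (p := 1 / (n : ℝ)) (Or.inl one_ne_zero)).inv₀ (by simp)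
    have h2 := (h1.smul (tendsto_id (x := 𝓝 (1 : Matrix (Fin n) (Fin n) ℝ)))).sub_const 1
    simpa using h2
  have hpos : ∀ᶠ Q : Matrix (Fin n) (Fin n) ℝ in 𝓝 1, 0 < Q.det := by
    have : Continuous fun Q : Matrix (Fin n) (Fin n) ℝ => Q.det := continuous_id.matrix_det
    exact this.continuousAt.eventually_const_lt (by simp)
  filter_upwards [hcont.eventually (hL.eventually_one_lt_det hL' hne), hpos] with Q hQ hQpos hsymm
  by_contra! hlt
  set d := Q.det ^ (1 / (n : ℝ)) with hd
  have hdpos : 0 < d := Real.rpow_pos_of_pos hQpos _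
  have hdn : d ^ n = Q.det := by
    rw [hd, one_div, Real.rpow_inv_natCast_pow hQpos.le (by omega)]
  have h1 := hQ ?_ ?_
  · have h2 : (1 + Matrix.of (d⁻¹ • Q - 1 : Matrix (Fin n) (Fin n) ℝ)).det = 1 := by
      have : (1 + Matrix.of (d⁻¹ • Q - 1 : Matrix (Fin n) (Fin n) ℝ)) = d⁻¹ • Q :=
        add_sub_cancel 1 (d⁻¹ • Q)
      rw [this, Matrix.det_smul, Fintype.card_fin, inv_pow, hdn, inv_mul_cancel₀ hQpos.ne']
    exact absurd h1 (by rw [h2]; exact lt_irrefl 1)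
  · intro i j
    exact ((hsymm.smul d⁻¹).sub Matrix.isSymm_one).apply j i
  · intro x hx
    have h3 : quad (d⁻¹ • Q - 1 : Matrix (Fin n) (Fin n) ℝ) x =
        d⁻¹ * quad Q x - quad (1 : Matrix (Fin n) (Fin n) ℝ) x := by
      simp only [quad, Finset.mul_sum, ← Finset.sum_sub_distrib]
      refine Finset.sum_congr rfl fun i _ => Finset.sum_congr rfl fun j _ => ?_
      simp only [Matrix.sub_apply, Matrix.smul_apply, smul_eq_mul]
      ring
    rw [h3, quad_one, (mem_minVectors.1 hx).2, sub_pos, lt_inv_mul_iff₀ hdpos, mul_comm]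
    exact hlt x hx

/-! ### The Hermite function in a neighbourhood of a basis -/

theorem det_pos (L : EuclideanLattice n) : 0 < L.det :=
  pow_pos (ZLattice.covolume_pos L.carrier volume) 2

theorem det_of_map {L M : EuclideanLattice n}
    (σ : EuclideanSpace ℝ (Fin n) ≃ₗ[ℝ] EuclideanSpace ℝ (Fin n))
    (hL : σ '' (L.carrier : Set (EuclideanSpace ℝ (Fin n))) = M.carrier) :
    M.det = LinearMap.det
      (σ : EuclideanSpace ℝ (Fin n) →ₗ[ℝ] EuclideanSpace ℝ (Fin n)) ^ 2 * L.det := by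
  have hM : L.carrier.map
      (σ.restrictScalars ℤ : EuclideanSpace ℝ (Fin n) →ₗ[ℤ] EuclideanSpace ℝ (Fin n)) =
      M.carrier := SetLike.coe_injective hL
  let f : L.carrier ≃ₗ[ℤ] M.carrier :=
    ((σ.restrictScalars ℤ).submoduleMap L.carrier).trans (LinearEquiv.ofEq _ _ hM)
  have hf : ∀ x, ((f x : M.carrier) : EuclideanSpace ℝ (Fin n)) = σ x := fun x => rfl
  let c := Module.Free.chooseBasis ℤ L.carrier
  let b := c.reindex (c.indexEquiv c)
  classical
  let b₀ := b.ofZLatticeBasis ℝ L.carrier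
  have hb : ((↑) ∘ (b.map f) : _ → EuclideanSpace ℝ (Fin n)) =
      (σ : EuclideanSpace ℝ (Fin n) →ₗ[ℝ] EuclideanSpace ℝ (Fin n)) ∘ ((↑) ∘ b) := by
    ext1 i
    simp [hf]
  unfold det
  rw [ZLattice.covolume_eq_det_mul_measureReal M.carrier volume (b.map f) b₀,
    ZLattice.covolume_eq_det_mul_measureReal L.carrier volume b b₀, hb, Module.Basis.det_comp,
    abs_mul, mul_assoc, mul_pow, sq_abs]

theorem image_ofBasis_carrier (b : Module.Basis (Fin n) ℝ (EuclideanSpace ℝ (Fin n)))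
    (σ : EuclideanSpace ℝ (Fin n) ≃ₗ[ℝ] EuclideanSpace ℝ (Fin n)) :
    σ '' ((ofBasis b).carrier : Set (EuclideanSpace ℝ (Fin n))) = (ofBasis (b.map σ)).carrier := by
  have h := Submodule.map_span
    (σ.restrictScalars ℤ : EuclideanSpace ℝ (Fin n) →ₗ[ℤ] EuclideanSpace ℝ (Fin n)) (Set.range b)
  have h2 := congrArg (SetLike.coe : Submodule ℤ (EuclideanSpace ℝ (Fin n)) → Set _) h
  rw [← Set.range_comp, Submodule.map_coe] at h2
  have h3 : ⇑(b.map σ) = σ ∘ b := by ext1 i; simp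
  simp only [ofBasis, h3]
  exact h2

/-- The matrix in the standard basis of the linear map that carries `b₀` to the vectors `v`. -/
noncomputable def transitionMatrix (b₀ : Module.Basis (Fin n) ℝ (EuclideanSpace ℝ (Fin n)))
    (v : Fin n → EuclideanSpace ℝ (Fin n)) : Matrix (Fin n) (Fin n) ℝ :=
  LinearMap.toMatrix (EuclideanSpace.basisFun (Fin n) ℝ).toBasis
    (EuclideanSpace.basisFun (Fin n) ℝ).toBasis (b₀.constr ℝ v)

theorem continuous_transitionMatrix
    (b₀ : Module.Basis (Fin n) ℝ (EuclideanSpace ℝ (Fin n))) :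
    Continuous (transitionMatrix b₀) := by
  refine continuous_matrix fun i j => ?_
  simp only [transitionMatrix, LinearMap.toMatrix_apply, Module.Basis.constr_apply_fintype]
  simp only [OrthonormalBasis.coe_toBasis, OrthonormalBasis.coe_toBasis_repr_apply,
    EuclideanSpace.basisFun_repr]
  fun_prop

theorem transitionMatrix_self (b₀ : Module.Basis (Fin n) ℝ (EuclideanSpace ℝ (Fin n))) :
    transitionMatrix b₀ b₀ = 1 := by
  have : b₀.constr ℝ (b₀ : Fin n → EuclideanSpace ℝ (Fin n)) = LinearMap.id :=
    b₀.ext fun i => by simp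
  rw [transitionMatrix, this, LinearMap.toMatrix_id]

theorem quad_transpose_mul_self (A : Matrix (Fin n) (Fin n) ℝ)
    (σ : EuclideanSpace ℝ (Fin n) →ₗ[ℝ] EuclideanSpace ℝ (Fin n))
    (hA : A = LinearMap.toMatrix (EuclideanSpace.basisFun (Fin n) ℝ).toBasis
      (EuclideanSpace.basisFun (Fin n) ℝ).toBasis σ) (x : EuclideanSpace ℝ (Fin n)) :
    quad (A.transpose * A) x = ⟪σ x, σ x⟫ := by
  have h : ∀ k, σ x k = ∑ j, A k j * x j := by
    intro k
    have := congrFun (LinearMap.toMatrix_mulVec_repr (EuclideanSpace.basisFun (Fin n) ℝ).toBasis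
      (EuclideanSpace.basisFun (Fin n) ℝ).toBasis σ x) k
    rw [← hA] at this
    simpa [Matrix.mulVec, dotProduct] using this.symm
  simp only [quad, PiLp.inner_apply, h, Matrix.mul_apply, Matrix.transpose_apply, RCLike.inner_apply,
    conj_trivial, Finset.sum_mul_sum]
  simp only [Finset.sum_mul]
  rw [Finset.sum_congr rfl fun i _ => Finset.sum_comm, Finset.sum_comm]
  exact Finset.sum_congr rfl fun k _ => Finset.sum_congr rfl fun i _ =>
    Finset.sum_congr rfl fun j _ => by ring

/-- The Gram form of the map `σ` carrying `b₀` to `b` is near the identity. The minimal vector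
supplied by the previous estimate is sent by `σ` to a nonzero vector of the new lattice, which
bounds its minimum from above. -/
theorem IsPerfect.eventually_hermite_le (hn : 1 ≤ n)
    {b₀ : Module.Basis (Fin n) ℝ (EuclideanSpace ℝ (Fin n))}
    (hL : (ofBasis b₀).IsPerfect) (hL' : (ofBasis b₀).IsStronglyEutactic)
    (hne : (ofBasis b₀).minVectors.Nonempty) :
    ∀ᶠ v : Fin n → EuclideanSpace ℝ (Fin n) in 𝓝 ⇑b₀,
      ∀ b : Module.Basis (Fin n) ℝ (EuclideanSpace ℝ (Fin n)), ⇑b = v →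
        (ofBasis b).hermite ≤ (ofBasis b₀).hermite := by
  have hcont : Tendsto (fun v => (transitionMatrix b₀ v).transpose * transitionMatrix b₀ v)
      (𝓝 ⇑b₀) (𝓝 1) := by
    have hc := continuous_transitionMatrix b₀
    have := (hc.matrix_transpose.matrix_mul hc).tendsto ⇑b₀
    simpa [transitionMatrix_self] using this
  filter_upwards [hcont.eventually (hL.eventually_exists_quad_le hn hL' hne)] with v hv b hb
  obtain ⟨x, hx, hxq⟩ := hv (Matrix.isSymm_transpose_mul_self _)
  let σ := b₀.equiv b (Equiv.refl _)
  have hσ : b₀.constr ℝ v = (σ : EuclideanSpace ℝ (Fin n) →ₗ[ℝ] EuclideanSpace ℝ (Fin n)) :=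
    b₀.ext fun i => by simp [σ, ← hb]
  have hmap : b₀.map σ = b := Module.Basis.eq_of_apply_eq fun i => by simp [σ]
  have himg := image_ofBasis_carrier b₀ σ
  rw [hmap] at himg
  have hdet := det_of_map σ himg
  rw [quad_transpose_mul_self (transitionMatrix b₀ v) _ rfl, Matrix.det_mul, Matrix.det_transpose, transitionMatrix,
    LinearMap.det_toMatrix, hσ, ← sq] at hxq
  obtain ⟨hxL, hxm⟩ := mem_minVectors.1 hx
  have hx0 : x ≠ 0 := by
    rintro rfl
    have := (ofBasis b₀).minimum_pos hn
    rw [← hxm, inner_zero_left] at this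
    exact this.false
  have hσx : σ x ∈ (ofBasis b).carrier := by
    rw [← SetLike.mem_coe, ← himg]
    exact ⟨x, hxL, rfl⟩
  have hmin := ((ofBasis b).minimum_le hσx (by simpa using hx0)).trans hxq
  have hpos := Real.rpow_pos_of_pos (ofBasis b).det_pos (1 / (n : ℝ))
  have hpos₀ := Real.rpow_pos_of_pos (ofBasis b₀).det_pos (1 / (n : ℝ))
  rw [hermite, hermite, div_le_div_iff₀ hpos hpos₀, hdet,
    Real.mul_rpow (sq_nonneg _) (ofBasis b₀).det_pos.le, ← mul_assoc]
  exact mul_le_mul_of_nonneg_right hmin hpos₀.le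

end EuclideanLattice

/-! ### The topology of the space of similarity classes -/

namespace EuclideanLattice

open Filter Topology

variable {n : ℕ}

theorem exists_ofBasis_eq (L : EuclideanLattice n) :
    ∃ b : Module.Basis (Fin n) ℝ (EuclideanSpace ℝ (Fin n)), ofBasis b = L := by
  let c := Module.Free.chooseBasis ℤ L.carrier
  let b₁ := c.ofZLatticeBasis ℝ L.carrier
  let b := b₁.reindex (b₁.indexEquiv (EuclideanSpace.basisFun (Fin n) ℝ).toBasis)
  refine ⟨b, ?_⟩
  have h : (ofBasis b).carrier = L.carrier := by
    simp only [ofBasis, b, Module.Basis.range_reindex]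
    exact c.ofZLatticeBasis_span ℝ L.carrier
  cases L
  simp only [ofBasis] at h ⊢
  congr

/-- The topology on the set of bases of Euclidean space. -/
noncomputable abbrev basisTopology (n : ℕ) :
    TopologicalSpace (Module.Basis (Fin n) ℝ (EuclideanSpace ℝ (Fin n))) :=
  TopologicalSpace.induced
    (fun (b : Module.Basis (Fin n) ℝ (EuclideanSpace ℝ (Fin n))) (i : Fin n) => b i) inferInstance

theorem mem_ofBasis_carrier_iff (b : Module.Basis (Fin n) ℝ (EuclideanSpace ℝ (Fin n)))
    (x : EuclideanSpace ℝ (Fin n)) :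
    x ∈ (ofBasis b).carrier ↔ ∀ i, b.equivFun x i ∈ Set.range ((↑) : ℤ → ℝ) :=
  b.mem_span_iff_repr_mem ℤ x

/-- If two bases span similar lattices, then the first is carried to the second by a continuous
self-map of the space of bases that preserves the similarity class of the lattice spanned. -/
theorem exists_continuous_of_similar
    {b b' : Module.Basis (Fin n) ℝ (EuclideanSpace ℝ (Fin n))}
    (h : Similar (ofBasis b) (ofBasis b')) :
    ∃ Ψ : Module.Basis (Fin n) ℝ (EuclideanSpace ℝ (Fin n)) →
        Module.Basis (Fin n) ℝ (EuclideanSpace ℝ (Fin n)),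
      @Continuous _ _ (basisTopology n) (basisTopology n) Ψ ∧ Ψ b = b' ∧
        ∀ c, Similar (ofBasis c) (ofBasis (Ψ c)) := by
  obtain ⟨σ, α, hα, hσ, himg⟩ := h
  -- `G` is `σ` in the coordinates of `b` and `b'`. It preserves integrality in both directions
  -- (`hG`), so it acts as an element of `GLₙ(ℤ)`. Thus `Ψ c` is the basis `σ ∘ c` followed by a
  -- fixed integral change of basis.
  let G : (Fin n → ℝ) ≃ₗ[ℝ] (Fin n → ℝ) := b.equivFun.symm.trans (σ.trans b'.equivFun)
  have hG : ∀ z : Fin n → ℝ, (∀ i, G z i ∈ Set.range ((↑) : ℤ → ℝ)) ↔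
      ∀ i, z i ∈ Set.range ((↑) : ℤ → ℝ) := by
    intro z
    have h1 := mem_ofBasis_carrier_iff b (b.equivFun.symm z)
    have h2 := mem_ofBasis_carrier_iff b' (σ (b.equivFun.symm z))
    rw [LinearEquiv.apply_symm_apply] at h1
    rw [← h1, ← SetLike.mem_coe (p := (ofBasis b).carrier), ← σ.injective.mem_set_image, himg]
    exact h2.symm
  let Ψ (c : Module.Basis (Fin n) ℝ (EuclideanSpace ℝ (Fin n))) :
      Module.Basis (Fin n) ℝ (EuclideanSpace ℝ (Fin n)) :=
    Module.Basis.ofEquivFun (σ.symm.trans (c.equivFun.trans G))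
  have hΨ : ∀ c i, Ψ c i = ∑ j, G.symm (Pi.single i 1) j • σ (c j) := by
    intro c i
    simp [Ψ, Module.Basis.coe_ofEquivFun, Module.Basis.equivFun_symm_apply]
  refine ⟨Ψ, ?_, ?_, fun c => ⟨σ, α, hα, hσ, ?_⟩⟩
  · let _ := basisTopology n
    rw [continuous_induced_rng]
    have hσc : Continuous σ := σ.toLinearMap.continuous_of_finiteDimensional
    have hcoe : ∀ j, Continuous
        fun c : Module.Basis (Fin n) ℝ (EuclideanSpace ℝ (Fin n)) => c j :=
      fun j => (continuous_apply j).comp continuous_induced_dom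
    refine continuous_pi fun i => ?_
    simp only [Function.comp_def, hΨ]
    exact continuous_finsetSum _ fun j _ =>
      (hσc.comp (hcoe j)).const_smul (G.symm (Pi.single i 1) j)
  · have : σ.symm.trans (b.equivFun.trans G) = b'.equivFun := by
      ext1 x
      simp [G]
    simp only [Ψ, this, Module.Basis.ofEquivFun_equivFun]
  · ext x
    rw [SetLike.mem_coe, mem_ofBasis_carrier_iff]
    simp only [Ψ, Module.Basis.equivFun_ofEquivFun, LinearEquiv.trans_apply]
    rw [hG, ← mem_ofBasis_carrier_iff]
    constructor
    · rintro ⟨y, hy, rfl⟩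
      simpa using hy
    · intro hx
      exact ⟨_, hx, by simp⟩

/-- A neighbourhood of bases yields one of classes only if it contains a saturated open set around
`b₀`. The interior of `S` is such a set, because similar bases are linked by continuous self-maps
that preserve classes. -/
theorem isExtreme_of_eventually_hermite_le
    {b₀ : Module.Basis (Fin n) ℝ (EuclideanSpace ℝ (Fin n))}
    (h : ∀ᶠ v : Fin n → EuclideanSpace ℝ (Fin n) in 𝓝 ⇑b₀,
      ∀ b : Module.Basis (Fin n) ℝ (EuclideanSpace ℝ (Fin n)), ⇑b = v →
        (ofBasis b).hermite ≤ (ofBasis b₀).hermite) :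
    (ofBasis b₀).IsExtreme := by
  let _ := basisTopology n
  let π : Module.Basis (Fin n) ℝ (EuclideanSpace ℝ (Fin n)) → SimilarityClass n :=
    fun b => Quotient.mk (similarSetoid n) (ofBasis b)
  let S := {b : Module.Basis (Fin n) ℝ (EuclideanSpace ℝ (Fin n)) |
    (ofBasis b).hermite ≤ (ofBasis b₀).hermite}
  have hS : S ∈ 𝓝 b₀ := by
    rw [nhds_induced]
    exact ⟨_, h, fun b hb => hb b rfl⟩
  have hsat : ∀ b b', Similar (ofBasis b) (ofBasis b') → b' ∈ interior S → b ∈ interior S := by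
    intro b b' hbb' hb'
    obtain ⟨Ψ, hΨ, hΨb, hsim⟩ := exists_continuous_of_similar hbb'
    -- The preimage of `interior S` under `Ψ` is open, contains `b`, and lies in `S` because
    -- `hermite` takes the same value at `c` and `Ψ c`.
    refine interior_maximal ?_ (isOpen_interior.preimage hΨ) (hΨb ▸ hb' : Ψ b ∈ interior S)
    intro c hc
    have hc' : (ofBasis (Ψ c)).hermite ≤ (ofBasis b₀).hermite :=
      interior_subset (s := S) hc
    rwa [← hermite_eq_of_similar (hsim c)] at hc'
  have hpre : π ⁻¹' (π '' interior S) = interior S := by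
    refine Set.Subset.antisymm ?_ (Set.subset_preimage_image _ _)
    rintro b ⟨b', hb', hbb'⟩
    exact hsat b b' (Quotient.exact hbb'.symm) hb'
  have hopen : IsOpen (π '' interior S) := by
    -- Two successive quotients: bases to lattices, then lattices to similarity classes.
    refine isOpen_coinduced.2 (isOpen_coinduced.2 ?_)
    change IsOpen (π ⁻¹' (π '' interior S))
    rw [hpre]
    exact isOpen_interior
  refine Filter.mem_of_superset
    (hopen.mem_nhds ⟨b₀, mem_interior_iff_mem_nhds.2 hS, rfl⟩) ?_
  rintro _ ⟨b, hb, rfl⟩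
  exact interior_subset (s := S) hb

/-- Voronoi: perfect and strongly eutactic lattices are extreme. -/
theorem IsPerfect.isExtreme (hn : 1 ≤ n) {L : EuclideanLattice n} (hL : L.IsPerfect)
    (hL' : L.IsStronglyEutactic) (hne : L.minVectors.Nonempty) : L.IsExtreme := by
  obtain ⟨b₀, rfl⟩ := L.exists_ofBasis_eq
  exact isExtreme_of_eventually_hermite_le (hL.eventually_hermite_le hn hL' hne)

end EuclideanLattice

theorem mainTheorem4 (n : ℕ) (hn : 1 ≤ n) (L : EuclideanLattice n) (hL : L.IsStronglyPerfect) :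
    L.IsStronglyEutactic ∧ L.IsPerfect ∧ L.IsExtreme :=
  ⟨hL.isStronglyEutactic hn, hL.isPerfect hn,
    (hL.isPerfect hn).isExtreme hn (hL.isStronglyEutactic hn) hL.1⟩
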